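/- **Conventions.** Let $(X,d)$ be a metric space. A *geodesic* is a curve $\sigma$ with $d(\sigma(t),\sigma(t'))=|t-t'|$ for all parameter values $t,t'$. A *bilaterally infinite local geodesic* is a curve $\rho:\mathbb R\to X$ that is a geodesic on a neighbourhood of each parameter value. The space $X$ is *CAT(1)* if any two points at distance $<\pi$ are joined by a geodesic and, for every geodesic triangle in $X$ of perimeter $<2\pi$, the distance between any two points of the triangle is at most the distance between the corresponding points of the triangle with the same side lengths in the unit sphere $S^2$ (with its great-circle distance). In *continuous simple pursuit* the evader moves along a curve $E:[0,\infty)\to X$ with speed $\le 1$ (that is, $E$ is $1$-Lipschitz), and the pursuer moves along a curve $P:[0,\infty)\to X$ with unit speed (the length of $P|_{[s,t]}$ is $t-s$ for $0\le s\le t$). For each $t\ge 0$ with $P(t)\ne E(t)$, the right-handed velocity vector of $P$ at $t$ exists and points along a geodesic from $P(t)$ to $E(t)$; that is, there is a geodesic $c:[0,d(P(t),E(t))]\to X$ from $P(t)$ to $E(t)$ with $d(P(t+s),c(s))=o(s)$ as $s\to 0^+$. The *evader wins* if $\lim_{t\to\infty}d(P(t),E(t))$ exists and is positive. **Proposition.**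 Let $X$ be a compact CAT(1) space. Suppose that the evader wins in a continuous simple pursuit $(P,E)$ in $X$ with initial distance $d(P(0),E(0))<\pi$. Then there is a bilaterally infinite local geodesic $\rho:\mathbb R\to X$ such that every finite segment of $\rho$ is the limit of segments of the pursuit curve $P$: for all $a<b$ there are $u_n\ge 0$ $(n\in\mathbb N)$ such that the curves $s\mapsto P(u_n+s-a)$, $s\in[a,b]$, converge uniformly on $[a,b]$ to $\rho|_{[a,b]}$. -/

import Mathlib

open Set Filter Topology

section Geodesics

variable {X : Type*} [MetricSpace X]

/-- `γ` is a (unit-speed) geodesic on the parameter set `s`. -/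
def IsGeodesicOn (γ : ℝ → X) (s : Set ℝ) : Prop :=
  ∀ t ∈ s, ∀ t' ∈ s, dist (γ t) (γ t') = |t - t'|

/-- `γ`, restricted to `[0, d(p,q)]`, is a unit-speed geodesic from `p` to `q`. -/
def IsGeodesicFromTo (γ : ℝ → X) (p q : X) : Prop :=
  γ 0 = p ∧ γ (dist p q) = q ∧ IsGeodesicOn γ (Icc 0 (dist p q))

/-- A bilaterally infinite local geodesic: a curve defined on all of `ℝ` which is a unit-speed
geodesic in a neighbourhood of each parameter value. -/
def IsBiinfiniteLocalGeodesic (ρ : ℝ → X) : Prop :=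
  ∀ t : ℝ, ∃ U ∈ 𝓝 t, IsGeodesicOn ρ U

end Geodesics

/-- The unit sphere `S²` of Euclidean 3-space, the model surface of curvature `1`. -/
abbrev ModelSphere : Type := Metric.sphere (0 : EuclideanSpace ℝ (Fin 3)) 1

/-- The intrinsic (great-circle) distance on the unit sphere. -/
noncomputable def sphericalDist (x y : ModelSphere) : ℝ :=
  InnerProductGeometry.angle (x : EuclideanSpace ℝ (Fin 3)) (y : EuclideanSpace ℝ (Fin 3))

/-- `p' q' r'` is a model triangle on the unit sphere for the points `p q r`. -/
def IsModelTriangle {X : Type*} [MetricSpace X] (p q r : X) (p' q' r' : ModelSphere) : Prop :=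
  sphericalDist p' q' = dist p q ∧ sphericalDist q' r' = dist q r ∧ sphericalDist r' p' = dist r p

/-- `x'` lies on the great-circle segment from `p'` to `q'`, at distance `s` from `p'`. -/
def IsModelPoint (p' q' x' : ModelSphere) (s : ℝ) : Prop :=
  sphericalDist p' x' = s ∧ sphericalDist x' q' = sphericalDist p' q' - s

/-- CAT(1) spaces: points at distance `< π` are joined by a geodesic, and in every geodesic triangle
of perimeter `< 2π` the distance between two points of the triangle is at most the distance between
the corresponding points of the model triangle in the unit sphere.

Two points on one side of a triangle satisfy the comparison trivially, and two different sides share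
a vertex, so the comparison is written for points on the sides `pq` and `pr`, for all labellings of
the vertices. All sides have length `< π`, so the third side always exists, and the model triangle
exists and is unique up to isometry, with unique corresponding points. -/
def IsCATOne (X : Type*) [MetricSpace X] : Prop :=
  (∀ p q : X, dist p q < Real.pi → ∃ c : ℝ → X, IsGeodesicFromTo c p q) ∧
  ∀ (p q r : X) (α β : ℝ → X), IsGeodesicFromTo α p q → IsGeodesicFromTo β p r →
    dist p q + dist q r + dist r p < 2 * Real.pi →
    ∀ p' q' r' : ModelSphere, IsModelTriangle p q r p' q' r' →
    ∀ s ∈ Icc 0 (dist p q), ∀ t ∈ Icc 0 (dist p r),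
    ∀ x' y' : ModelSphere, IsModelPoint p' q' x' s → IsModelPoint p' r' y' t →
      dist (α s) (β t) ≤ sphericalDist x' y'

section Pursuit

variable {X : Type*} [MetricSpace X]

/-- The right-handed velocity vector of `P` at time `t` exists and is the unit vector pointing along
the geodesic `c` issuing from `P t`: the curves `s ↦ P (t + s)` and `s ↦ c s` agree to first order
at `s = 0⁺`. -/
def HasRightVelocityAlong (P : ℝ → X) (t : ℝ) (c : ℝ → X) : Prop :=
  (fun s : ℝ => dist (P (t + s)) (c s)) =o[𝓝[>] 0] (fun s : ℝ => s)

/-- Continuous simple pursuit, in time `t ≥ 0`, of the evader `E` by the pursuer `P`: the evader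
moves with speed at most `1` (its path is `1`-Lipschitz, hence rectifiable on bounded time
intervals), the pursuer moves with unit speed (arclength on each time interval equals elapsed time),
and as long as there is a positive separation, the right-handed velocity vector of `P` exists and
points along a geodesic from `P t` to `E t`. -/
structure IsContinuousSimplePursuit (P E : ℝ → X) : Prop where
  evader_speed : LipschitzOnWith 1 E (Ici 0)
  pursuer_speed : HasUnitSpeedOn P (Ici 0)
  pursuer_direction : ∀ t : ℝ, 0 ≤ t → P t ≠ E t →
    ∃ c : ℝ → X, IsGeodesicFromTo c (P t) (E t) ∧ HasRightVelocityAlong P t c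

/-- The evader wins: the separation `d(P(t), E(t))` has a positive limit as `t → ∞`. -/
def EvaderWins (P E : ℝ → X) : Prop :=
  ∃ l : ℝ, 0 < l ∧ Tendsto (fun t : ℝ => dist (P t) (E t)) atTop (𝓝 l)

/-- The segment `ρ|[a,b]` is the limit of segments of the curve `P` (a curve on `[0,∞)`): there are
subsegments `P|[u n, u n + (b - a)]` which, translated to the parameter interval `[a,b]`,
converge uniformly to `ρ`. -/
def IsLimitOfSegments (P ρ : ℝ → X) (a b : ℝ) : Prop :=
  ∃ u : ℕ → ℝ, (∀ n, 0 ≤ u n) ∧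
    TendstoUniformlyOn (fun (n : ℕ) (s : ℝ) => P (u n + (s - a))) ρ atTop (Icc a b)

end Pursuit

/-! The separation d(P(t), E(t)) never increases (`dist_antitoneOn`), so its limit l is below π. As
`E` has speed at most 1, E(a+T) is within d(P(a), E(a)) + T of P(a); the crux
(`eventually_cos_dist_lt`) is that for l + T < π this bound is asymptotically attained. Indeed, on
the sphere with separation l, the extremal distance from P(t) to E(b), b = a+T, is l + (b - t). By
CAT(1) first variation, a definite deficit at time a would persist and leave the separation below l
at time b. The triangle inequality then forces d(P(a), P(a+T)) to tend to T (`eventually_lt_dist`):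
late pursuit segments are nearly geodesic at all scales below π - l, and compactness yields a limit
curve. -/

/-! ### Spherical trigonometry and CAT(1) comparison -/

/-- The point of the unit sphere with the given coordinates. -/
def spherePoint (x y z : ℝ) (h : x ^ 2 + y ^ 2 + z ^ 2 = 1) : ModelSphere :=
  ⟨!₂[x, y, z], by simp [EuclideanSpace.norm_eq, Fin.sum_univ_three, h]⟩

lemma sphericalDist_spherePoint {x y z x' y' z' : ℝ} (h : x ^ 2 + y ^ 2 + z ^ 2 = 1)
    (h' : x' ^ 2 + y' ^ 2 + z' ^ 2 = 1) :
    sphericalDist (spherePoint x y z h) (spherePoint x' y' z' h') =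
      Real.arccos (x * x' + y * y' + z * z') := by
  have hn : ∀ p : ModelSphere, ‖(p : EuclideanSpace ℝ (Fin 3))‖ = 1 := fun p ↦ by simp
  rw [sphericalDist, InnerProductGeometry.angle, hn, hn]
  simp [spherePoint, PiLp.inner_apply, Fin.sum_univ_three]
  congr 1; ring

/-- The spherical law of cosines is solvable under the triangle inequalities. -/
lemma sq_cos_sub_le {A B C : ℝ}
    (h1 : A ≤ B + C) (h2 : B ≤ A + C) (h3 : C ≤ A + B) (h4 : A + B + C ≤ 2 * Real.pi) :
    (Real.cos C - Real.cos A * Real.cos B) ^ 2 ≤ (Real.sin A * Real.sin B) ^ 2 := by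
  have hC0 : 0 ≤ C := by linarith
  have hCpi : C ≤ Real.pi := by linarith
  have up : Real.cos C ≤ Real.cos (A - B) := by
    rw [← Real.cos_abs (A - B)]
    exact Real.cos_le_cos_of_nonneg_of_le_pi (abs_nonneg _) hCpi
      (abs_le.2 ⟨by linarith, by linarith⟩)
  have lo : Real.cos (A + B) ≤ Real.cos C := by
    rcases le_total (A + B) Real.pi with h | h
    · exact Real.cos_le_cos_of_nonneg_of_le_pi hC0 h h3
    -- Past π, reflect: the perimeter bound says C ≤ 2π - (A + B).
    · rw [← Real.cos_two_pi_sub]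
      exact Real.cos_le_cos_of_nonneg_of_le_pi hC0 (by linarith) (by linarith)
  rw [Real.cos_sub] at up
  rw [Real.cos_add] at lo
  exact sq_le_sq' (by linarith) (by linarith)

/-- Comparison of the distance from a point to a point of a geodesic in a CAT(1) space. -/
lemma IsCATOne.le_sin_mul_cos_dist {X : Type*} [MetricSpace X] (hX : IsCATOne X) {p q z : X}
    {c : ℝ → X} (hc : IsGeodesicFromTo c p q) (h0 : 0 < dist p q) (hpi : dist p q < Real.pi)
    (hper : dist p q + dist q z + dist z p < 2 * Real.pi) {s : ℝ} (hs : s ∈ Icc 0 (dist p q)) :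
    Real.sin (dist p q - s) * Real.cos (dist p z) + Real.sin s * Real.cos (dist q z) ≤
      Real.sin (dist p q) * Real.cos (dist (c s) z) := by
  have t1 := dist_triangle p z q
  have t2 := dist_triangle p q z
  have t3 := dist_triangle q p z
  rw [dist_comm z q] at t1
  rw [dist_comm q p] at t3
  rw [dist_comm z p] at hper
  have hB : dist p z < Real.pi := by linarith
  have hC : dist q z < Real.pi := by linarith
  obtain ⟨β, hβ⟩ := hX.1 p z hB
  have hp0 : 0 ≤ dist p z := dist_nonneg
  have hq0 : 0 ≤ dist q z := dist_nonneg
  have key := sq_cos_sub_le t1 t2 (by linarith) (by linarith)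
  set A := dist p q
  set B := dist p z
  set C := dist q z
  have hsA : 0 < Real.sin A := Real.sin_pos_of_pos_of_lt_pi h0 hpi
  -- Model vertices: (1, 0, 0), (cos A, sin A, 0) and (cos B, y, ·), with `y` forced by the third
  -- side `C`.
  obtain ⟨y, hy⟩ : ∃ y, y = (Real.cos C - Real.cos A * Real.cos B) / Real.sin A := ⟨_, rfl⟩
  have hy' : Real.sin A * y = Real.cos C - Real.cos A * Real.cos B := by
    rw [hy]; field_simp
  have hyB : y ^ 2 ≤ Real.sin B ^ 2 := by
    rw [← hy', mul_pow, mul_pow] at key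
    exact le_of_mul_le_mul_left key (by positivity)
  have hcs : ∀ u : ℝ, Real.cos u ^ 2 + Real.sin u ^ 2 + (0 : ℝ) ^ 2 = 1 := fun u ↦ by
    rw [Real.cos_sq_add_sin_sq]; norm_num
  have hr : Real.cos B ^ 2 + y ^ 2 + Real.sqrt (Real.sin B ^ 2 - y ^ 2) ^ 2 = 1 := by
    rw [Real.sq_sqrt (by linarith)]
    linarith [Real.cos_sq_add_sin_sq B]
  have hdist : ∀ u v : ℝ, u ≤ v → v - u ≤ Real.pi →
      sphericalDist (spherePoint _ _ _ (hcs u)) (spherePoint _ _ _ (hcs v)) = v - u := by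
    intro u v huv hvu
    rw [sphericalDist_spherePoint, ← Real.arccos_cos (sub_nonneg.2 huv) hvu, Real.cos_sub]
    congr 1; ring
  have hx : ∀ u : ℝ, sphericalDist (spherePoint _ _ _ (hcs u)) (spherePoint _ _ _ hr) =
      Real.arccos (Real.cos u * Real.cos B + Real.sin u * y) := fun u ↦ by
    rw [sphericalDist_spherePoint, zero_mul, add_zero]
  have hself : sphericalDist (spherePoint _ _ _ hr) (spherePoint _ _ _ hr) = 0 :=
    InnerProductGeometry.angle_self (ne_zero_of_mem_unit_sphere _)
  have hcomm : ∀ x y : ModelSphere, sphericalDist x y = sphericalDist y x := fun x y ↦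
    InnerProductGeometry.angle_comm _ _
  have hpq := hdist 0 A h0.le (by linarith)
  have hpr : sphericalDist (spherePoint _ _ _ (hcs 0)) (spherePoint _ _ _ hr) = B := by
    rw [hx]; simp [Real.arccos_cos hp0 hB.le]
  have hqr : sphericalDist (spherePoint _ _ _ (hcs A)) (spherePoint _ _ _ hr) = C := by
    rw [hx, hy', add_sub_cancel, Real.arccos_cos hq0 hC.le]
  have main := hX.2 p q z c β hc hβ (by rw [dist_comm z p]; linarith) _ _ _
    ⟨hpq.trans (sub_zero _), hqr, by rw [hcomm, hpr, dist_comm]⟩ s hs B ⟨hp0, le_rfl⟩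
    (spherePoint _ _ _ (hcs s)) (spherePoint _ _ _ hr)
    ⟨by rw [hdist 0 s hs.1 (by linarith [hs.2]), sub_zero],
      by rw [hpq, hdist s A hs.2 (by linarith [hs.1])]; ring⟩
    ⟨hpr, by rw [hself, hpr, sub_self]⟩
  rw [hβ.2.1] at main
  have hcos := Real.cos_le_cos_of_nonneg_of_le_pi dist_nonneg
    (InnerProductGeometry.angle_le_pi _ _) main
  change Real.cos (sphericalDist _ _) ≤ _ at hcos
  have hle : Real.cos s * Real.cos B + Real.sin s * y ≤
      Real.cos (sphericalDist (spherePoint _ _ _ (hcs s)) (spherePoint _ _ _ hr)) := by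
    have h1 : Real.cos s ^ 2 + Real.sin s ^ 2 = 1 := Real.cos_sq_add_sin_sq s
    have h2 : Real.cos B ^ 2 + Real.sin B ^ 2 = 1 := Real.cos_sq_add_sin_sq B
    have h3 : (Real.cos s * Real.cos B + Real.sin s * y) ^ 2 ≤ 1 ^ 2 := by
      nlinarith [sq_nonneg (Real.cos s * y - Real.sin s * Real.cos B),
        mul_le_mul_of_nonneg_left hyB (sq_nonneg (Real.cos s)),
        mul_le_mul_of_nonneg_left hyB (sq_nonneg (Real.sin s))]
    rw [hx, Real.cos_arccos (abs_le_of_sq_le_sq' h3 zero_le_one).1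
      (abs_le_of_sq_le_sq' h3 zero_le_one).2]
  -- Along a great circle the inner product with a fixed point is a sinusoid, determined by its
  -- values cos B and cos C at the ends.
  calc Real.sin (A - s) * Real.cos B + Real.sin s * Real.cos C
      = Real.sin A * (Real.cos s * Real.cos B + Real.sin s * y) := by
        rw [Real.sin_sub]; linear_combination (-Real.sin s) * hy'
    _ ≤ _ := mul_le_mul_of_nonneg_left (hle.trans hcos) hsA.le

/-! ### Speed bounds and monotone separation -/

lemma HasUnitSpeedOn.lipschitzOnWith {X : Type*} [PseudoEMetricSpace X] {P : ℝ → X} {s : Set ℝ}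
    (h : HasUnitSpeedOn P s) : LipschitzOnWith 1 P s := by
  intro x hx y hy
  wlog hxy : x ≤ y generalizing x y
  · rw [edist_comm, edist_comm x]
    exact this hy hx (le_of_not_ge hxy)
  calc edist (P x) (P y) ≤ eVariationOn P (s ∩ Icc x y) :=
        eVariationOn.edist_le P ⟨hx, le_rfl, hxy⟩ ⟨hy, hxy, le_rfl⟩
    _ = ENNReal.ofReal (y - x) := by rw [h hx hy]; simp
    _ = _ := by
      rw [edist_dist, dist_comm, Real.dist_eq, abs_of_nonneg (sub_nonneg.2 hxy)]; simp

/-- A real function that to first order, from the right, is at most `c * s` satisfies a slope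
bound. -/
lemma eventually_slope_lt {f g e : ℝ → ℝ} {x c r : ℝ} (hcr : c < r)
    (hg : HasDerivAt g c 0) (he : e =o[𝓝[>] 0] (fun s : ℝ ↦ s))
    (hf : ∀ᶠ s in 𝓝[>] 0, f (x + s) - f x ≤ g s - g 0 + e s) :
    ∀ᶠ z in 𝓝[>] x, slope f x z < r := by
  have h1 : ∀ᶠ s in 𝓝[>] (0 : ℝ), slope g 0 s < (c + r) / 2 :=
    (hasDerivAt_iff_tendsto_slope.1 hg).mono_left (nhdsWithin_mono _ fun y hy ↦ ne_of_gt hy)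
      |>.eventually_lt_const (by linarith)
  have h2 := he.def (c := (r - c) / 2) (by linarith)
  have h3 : ∀ᶠ s in 𝓝[>] (0 : ℝ), slope f x (x + s) < r := by
    filter_upwards [h1, h2, hf, self_mem_nhdsWithin] with s h1 h2 hf hs
    have hs : 0 < s := hs
    rw [slope_def_field, sub_zero, div_lt_iff₀ hs] at h1
    rw [slope_def_field, add_sub_cancel_left, div_lt_iff₀ hs]
    rw [Real.norm_of_nonneg hs.le] at h2
    have := (le_abs_self _).trans h2
    linarith
  have hmap : Tendsto (fun z ↦ z - x) (𝓝[>] x) (𝓝[>] 0) := by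
    refine tendsto_nhdsWithin_iff.2 ⟨?_, ?_⟩
    · exact ((continuous_id.sub continuous_const).tendsto' x 0 (sub_self x)).mono_left
        nhdsWithin_le_nhds
    · filter_upwards [self_mem_nhdsWithin] with z hz using mem_Ioi.2 (sub_pos.2 (mem_Ioi.1 hz))
  filter_upwards [hmap.eventually h3] with z hz
  simpa using hz

namespace IsContinuousSimplePursuit

variable {X : Type*} [MetricSpace X] {P E : ℝ → X}

lemma continuousOn_dist (h : IsContinuousSimplePursuit P E) {a b : ℝ} (ha : 0 ≤ a) :
    ContinuousOn (fun t ↦ dist (P t) (E t)) (Icc a b) :=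
  (continuous_dist.comp_continuousOn (h.pursuer_speed.lipschitzOnWith.continuousOn.prodMk
    h.evader_speed.continuousOn)).mono
    fun _ ht ↦ ha.trans ht.1

lemma dist_evader_le (h : IsContinuousSimplePursuit P E) {s t : ℝ} (hs : 0 ≤ s) (hst : s ≤ t) :
    dist (E s) (E t) ≤ t - s := by
  have := h.evader_speed.dist_le_mul s hs t (hs.trans hst)
  rwa [dist_comm s, Real.dist_eq, abs_of_nonneg (sub_nonneg.2 hst), NNReal.coe_one, one_mul] at this

lemma dist_pursuer_le (h : IsContinuousSimplePursuit P E) {s t : ℝ} (hs : 0 ≤ s) (ht : 0 ≤ t) :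
    dist (P s) (P t) ≤ |s - t| := by
  simpa [Real.dist_eq] using h.pursuer_speed.lipschitzOnWith.dist_le_mul s hs t ht

/-- The pursuer closes in at unit rate and the evader recedes no faster. -/
lemma dist_antitoneOn (h : IsContinuousSimplePursuit P E) :
    AntitoneOn (fun t ↦ dist (P t) (E t)) (Ici 0) := by
  classical
  intro a (ha : 0 ≤ a) b _ hab
  have hslope : ∀ x ∈ Ico a b, ∀ r, (if P x = E x then 2 else 0 : ℝ) < r →
      ∀ᶠ z in 𝓝[>] x, slope (fun t ↦ dist (P t) (E t)) x z < r := by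
    intro x hx r hr
    have hx0 := ha.trans hx.1
    split_ifs at hr with heq
    · have hd : HasDerivAt (fun s : ℝ ↦ 2 * s) 2 0 := by
        simpa using (hasDerivAt_id (0 : ℝ)).const_mul 2
      refine eventually_slope_lt hr hd (Asymptotics.isLittleO_zero _ _) ?_
      filter_upwards [self_mem_nhdsWithin] with s hs
      have hs : 0 < s := hs
      have h1 := h.dist_pursuer_le (add_nonneg hx0 hs.le) hx0
      have h2 := h.dist_evader_le hx0 (le_add_of_nonneg_right hs.le)
      have h3 := dist_triangle (P (x + s)) (P x) (E (x + s))
      rw [add_sub_cancel_left, abs_of_pos hs] at h1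
      rw [heq] at h1 h3
      simp only [heq, dist_self]
      linarith
    · obtain ⟨c, hc, hv⟩ := h.pursuer_direction x hx0 heq
      refine eventually_slope_lt hr (hasDerivAt_const (0 : ℝ) (0 : ℝ)) hv ?_
      filter_upwards [Ioo_mem_nhdsGT (dist_pos.2 heq)] with s hs
      have h1 := hc.2.2 s ⟨hs.1.le, hs.2.le⟩ _ ⟨dist_nonneg, le_rfl⟩
      rw [hc.2.1, abs_sub_comm, abs_of_pos (sub_pos.2 hs.2)] at h1
      have h2 := h.dist_evader_le hx0 (le_add_of_nonneg_right hs.1.le)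
      have h3 := dist_triangle4 (P (x + s)) (c s) (E x) (E (x + s))
      linarith
  have hfence : ∀ ε > 0, dist (P b) (E b) ≤ dist (P a) (E a) + ε + ε * (b - a) := by
    -- The barrier stays positive, so contact occurs only where `P x ≠ E x`; the crude slope bound 2
    -- at capture is harmless.
    intro ε hε
    refine image_le_of_liminf_slope_right_lt_deriv_boundary
      (f := fun t ↦ dist (P t) (E t)) (a := a) (b := b)
      (B := fun t ↦ dist (P a) (E a) + ε + ε * (t - a)) (B' := fun _ ↦ ε)
      (h.continuousOn_dist ha) (fun x hx r hr ↦ (hslope x hx r hr).frequently) ?_ ?_ ?_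
      ⟨hab, le_rfl⟩
    · simpa using hε.le
    · intro x
      simpa using (((hasDerivAt_id x).sub_const a).const_mul ε).const_add (dist (P a) (E a) + ε)
    · intro x hx hxB
      have : 0 ≤ ε * (x - a) := mul_nonneg hε.le (sub_nonneg.2 hx.1)
      have hne : P x ≠ E x := dist_pos.1 (by
        rw [hxB]; linarith [dist_nonneg (x := P a) (y := E a)])
      simpa [hne] using hε
  have hlim : Tendsto (fun ε : ℝ ↦ dist (P a) (E a) + ε + ε * (b - a)) (𝓝[>] 0)
      (𝓝 (dist (P a) (E a))) := by
    have : Continuous fun ε : ℝ ↦ dist (P a) (E a) + ε + ε * (b - a) := by fun_prop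
    exact (this.tendsto' 0 _ (by simp)).mono_left nhdsWithin_le_nhds
  exact ge_of_tendsto hlim (by filter_upwards [self_mem_nhdsWithin] with ε hε using hfence ε hε)

/-! ### First variation and the barrier argument -/

/-- The first variation inequality for the distance of the pursuer to a fixed point. -/
lemma eventually_slope_neg_cos_dist_lt (hX : IsCATOne X) (h : IsContinuousSimplePursuit P E)
    {t : ℝ} (ht : 0 ≤ t) {z : X} (h0 : 0 < dist (P t) (E t)) (hpi : dist (P t) (E t) < Real.pi)
    (hper : dist (P t) (E t) + dist (E t) z + dist z (P t) < 2 * Real.pi) {r : ℝ}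
    (hr : -((Real.cos (dist (E t) z) - Real.cos (dist (P t) (E t)) * Real.cos (dist (P t) z)) /
      Real.sin (dist (P t) (E t))) < r) :
    ∀ᶠ u in 𝓝[>] t, slope (fun u ↦ -Real.cos (dist (P u) z)) t u < r := by
  obtain ⟨c, hc, hv⟩ := h.pursuer_direction t ht (dist_pos.1 h0)
  have hsin := Real.sin_pos_of_pos_of_lt_pi h0 hpi
  have hg : HasDerivAt (fun s ↦ -((Real.sin (dist (P t) (E t) - s) * Real.cos (dist (P t) z) +
      Real.sin s * Real.cos (dist (E t) z)) / Real.sin (dist (P t) (E t))))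
      (-((Real.cos (dist (E t) z) - Real.cos (dist (P t) (E t)) * Real.cos (dist (P t) z)) /
        Real.sin (dist (P t) (E t)))) 0 := by
    have h1 := (((hasDerivAt_id (0 : ℝ)).const_sub (dist (P t) (E t))).sin).mul_const
      (Real.cos (dist (P t) z))
    have h2 := (Real.hasDerivAt_sin 0).mul_const (Real.cos (dist (E t) z))
    convert! ((h1.add h2).div_const (Real.sin (dist (P t) (E t)))).neg using 1
    simp; ring
  refine eventually_slope_lt hr hg hv ?_
  filter_upwards [Ioo_mem_nhdsGT h0] with s hs
  -- Comparison is an equality at s = 0, so its derivative there bounds the slope; replacing `P (t +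
  -- s)` by `c s` costs o(s).
  have h1 := hX.le_sin_mul_cos_dist hc h0 hpi hper ⟨hs.1.le, hs.2.le⟩
  rw [← div_le_iff₀' hsin] at h1
  have h2 := (abs_le.1 (Real.abs_cos_sub_cos_le (dist (P (t + s)) z) (dist (c s) z))).1
  have h3 := abs_dist_sub_le (P (t + s)) (c s) z
  simp only [sub_zero, Real.sin_zero, zero_mul, add_zero]
  rw [mul_div_cancel_left₀ _ hsin.ne']
  linarith

end IsContinuousSimplePursuit

/-- A strict differential inequality for a barrier function persists under small changes of a
parameter. -/
lemma eventually_barrier {l : ℝ} (hl0 : 0 < l) (hlpi : l < Real.pi) (T : ℝ) {K : ℝ} (hK : 0 < K) :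
    ∀ᶠ L in 𝓝 l, ∀ τ ∈ Icc 0 T,
      Real.sin (l + τ) - (Real.cos l / Real.sin l + 1) *
          (K * Real.exp (-((Real.cos l / Real.sin l + 1) * (T - τ)))) <
        (Real.cos τ - Real.cos L * (Real.cos (l + τ) +
          K * Real.exp (-((Real.cos l / Real.sin l + 1) * (T - τ))))) / Real.sin L := by
  have hsin := Real.sin_pos_of_pos_of_lt_pi hl0 hlpi
  -- Compactness of [0, T] reduces the claim to L = l.
  refine isCompact_Icc.eventually_forall_of_forall_eventually fun τ _ ↦ ?_
  refine ContinuousAt.eventually_lt (f := fun z : ℝ × ℝ ↦ Real.sin (l + z.2) -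
    (Real.cos l / Real.sin l + 1) *
      (K * Real.exp (-((Real.cos l / Real.sin l + 1) * (T - z.2)))))
    (g := fun z : ℝ × ℝ ↦ (Real.cos z.2 - Real.cos z.1 * (Real.cos (l + z.2) +
      K * Real.exp (-((Real.cos l / Real.sin l + 1) * (T - z.2))))) / Real.sin z.1) ?_ ?_ ?_
  · fun_prop
  · exact ContinuousAt.div (by fun_prop) (by fun_prop) hsin.ne'
  · have hM : 0 < K * Real.exp (-((Real.cos l / Real.sin l + 1) * (T - τ))) := by positivity
    simp only
    generalize K * Real.exp (-((Real.cos l / Real.sin l + 1) * (T - τ))) = M at *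
    have hτ : Real.cos τ = Real.cos (l + τ) * Real.cos l + Real.sin (l + τ) * Real.sin l := by
      rw [← Real.cos_sub, add_sub_cancel_left]
    -- At L = l the unperturbed terms cancel; the `+ 1` in the decay rate leaves the margin `M`.
    have : (Real.cos τ - Real.cos l * (Real.cos (l + τ) + M)) / Real.sin l =
        Real.sin (l + τ) - Real.cos l / Real.sin l * M := by
      rw [hτ]; field_simp; ring
    rw [this]
    linarith

namespace IsContinuousSimplePursuit

variable {X : Type*} [MetricSpace X] {P E : ℝ → X}

/-- The evader's later positions are asymptotically as far from the pursuer as possible. -/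
lemma eventually_cos_dist_lt (hX : IsCATOne X) (h : IsContinuousSimplePursuit P E) {l : ℝ}
    (hl0 : 0 < l) (hl : Tendsto (fun t ↦ dist (P t) (E t)) atTop (𝓝 l)) {T : ℝ} (hT : 0 ≤ T)
    (hlT : l + T < Real.pi) {K : ℝ} (hK : 0 < K) :
    ∀ᶠ a in atTop, Real.cos (dist (P a) (E (a + T))) < Real.cos (l + T) + K := by
  have hlpi : l < Real.pi := by linarith
  have hev := eventually_forall_ge_atTop.2
    (((hl.eventually (eventually_barrier hl0 hlpi T hK)).and
      (hl.eventually_lt_const (show l < Real.pi - T by linarith))).and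
      (eventually_ge_atTop 0))
  set κ := Real.cos l / Real.sin l + 1
  have hge : ∀ t, 0 ≤ t → l ≤ dist (P t) (E t) := fun t ht ↦
    le_of_tendsto hl (by
      filter_upwards [eventually_ge_atTop t] with s hs
      exact h.dist_antitoneOn ht (ht.trans hs) hs)
  filter_upwards [hev] with a ha
  by_contra! hcon
  have ha0 : 0 ≤ a := (ha a le_rfl).2
  have hab : a ≤ a + T := by linarith
  set b := a + T with hb
  have hb0 : 0 ≤ b := ha0.trans hab
  have hcont : ContinuousOn (fun t ↦ -Real.cos (dist (P t) (E b))) (Icc a b) := by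
    have hP : ContinuousOn P (Icc a b) :=
      h.pursuer_speed.lipschitzOnWith.continuousOn.mono fun _ ht ↦ ha0.trans ht.1
    exact (Real.continuous_cos.comp_continuousOn
      (continuous_dist.comp_continuousOn (hP.prodMk continuousOn_const))).neg
  -- The exact spherical solution plus a decaying deficit: it is K at time a, as in `hcon`, and
  -- still positive at time b, where `hge` forbids it.
  have hfence := image_le_of_liminf_slope_right_lt_deriv_boundary
    (B := fun t ↦ -(Real.cos (l + (b - t)) + K * Real.exp (-(κ * (t - a)))))
    (B' := fun t ↦ -(Real.sin (l + (b - t)) - κ * (K * Real.exp (-(κ * (t - a))))))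
    (f' := fun t ↦ -((Real.cos (dist (E t) (E b)) -
      Real.cos (dist (P t) (E t)) * Real.cos (dist (P t) (E b))) / Real.sin (dist (P t) (E t))))
    hcont ?_ ?_ ?_ ?_ (right_mem_Icc.2 hab)
  · have hpos : 0 < K * Real.exp (-(κ * (b - a))) := by positivity
    have hcos := Real.cos_le_cos_of_nonneg_of_le_pi hl0.le
      (by linarith [(ha b hab).1.2]) (hge b hb0)
    simp only [sub_self, add_zero] at hfence
    linarith
  · intro t ht r hr
    have ht0 := ha0.trans ht.1
    have h1 := h.dist_evader_le ht0 ht.2.le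
    have h2 := (ha t ht.1).1.2
    have h3 := dist_triangle (P t) (E t) (E b)
    have h4 := ht.1
    refine (h.eventually_slope_neg_cos_dist_lt hX ht0 (hl0.trans_le (hge t ht0)) (by linarith)
      ?_ hr).frequently
    rw [dist_comm (E b)]
    linarith
  · simp only [sub_self, mul_zero, neg_zero, Real.exp_zero, mul_one]
    rw [hb, add_sub_cancel_left, ← hb]
    linarith
  · intro t
    have h1 := (((hasDerivAt_id t).const_sub b).const_add l).cos
    have h2 := ((((hasDerivAt_id t).sub_const a).const_mul κ).neg.exp).const_mul K
    convert! (h1.add h2).neg using 1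
    simp; ring
  · intro t ht htB
    have ht0 := ha0.trans ht.1
    have h1 := h.dist_evader_le ht0 ht.2.le
    have h2 := (ha t ht.1).1.2
    have h4 := ht.1
    have hL0 := hl0.trans_le (hge t ht0)
    have hcos : Real.cos (b - t) ≤ Real.cos (dist (E t) (E b)) :=
      Real.cos_le_cos_of_nonneg_of_le_pi dist_nonneg (by linarith) h1
    have hsin := Real.sin_pos_of_pos_of_lt_pi hL0 (by linarith)
    have hbar := (ha t ht.1).1.1 (b - t) ⟨by linarith [ht.2], by linarith⟩
    rw [show T - (b - t) = t - a by rw [hb]; ring] at hbar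
    rw [neg_inj.1 htB]
    refine neg_lt_neg (hbar.trans_le ?_)
    gcongr

/-- Segments of the pursuit curve are asymptotically geodesic at a uniform scale. -/
lemma eventually_lt_dist (hX : IsCATOne X) (h : IsContinuousSimplePursuit P E) {l : ℝ}
    (hl0 : 0 < l) (hl : Tendsto (fun t ↦ dist (P t) (E t)) atTop (𝓝 l)) {T : ℝ} (hT : 0 ≤ T)
    (hlT : l + T < Real.pi) {c : ℝ} (hc : c < T) :
    ∀ᶠ a in atTop, c < dist (P a) (P (a + T)) := by
  -- One η is lost in each of the two distance estimates; η ≤ l keeps l + T - η nonnegative.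
  obtain ⟨η, hη, hηl, hηc⟩ : ∃ η, 0 < η ∧ η ≤ l ∧ 2 * η ≤ T - c :=
    ⟨min l ((T - c) / 2), lt_min hl0 (by linarith), min_le_left _ _,
      by linarith [min_le_right l ((T - c) / 2)]⟩
  have hK : 0 < Real.cos (l + T - η) - Real.cos (l + T) :=
    sub_pos.2 (Real.cos_lt_cos_of_nonneg_of_le_pi (by linarith) hlT.le (by linarith))
  have hshift : Tendsto (fun a : ℝ ↦ a + T) atTop atTop := tendsto_atTop_add_const_right _ _ tendsto_id
  filter_upwards [h.eventually_cos_dist_lt hX hl0 hl hT hlT hK,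
    (hl.comp hshift).eventually_lt_const (show l < l + η by linarith)] with a h1 h2
  have h3 : l + T - η < dist (P a) (E (a + T)) := by
    by_contra! hle
    have := Real.cos_le_cos_of_nonneg_of_le_pi dist_nonneg (by linarith) hle
    linarith
  have h4 := dist_triangle (P a) (P (a + T)) (E (a + T))
  simp only [Function.comp_apply] at h2
  linarith

end IsContinuousSimplePursuit

/-! ### The limit geodesic -/

theorem mainTheorem12 {X : Type*} [MetricSpace X] [CompactSpace X] (hX : IsCATOne X)
    (P E : ℝ → X) (hpursuit : IsContinuousSimplePursuit P E)
    (hinit : dist (P 0) (E 0) < Real.pi) (hwin : EvaderWins P E) :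
    ∃ ρ : ℝ → X, IsBiinfiniteLocalGeodesic ρ ∧
      ∀ a b : ℝ, a < b → IsLimitOfSegments P ρ a b := by
  obtain ⟨l, hl0, hl⟩ := hwin
  have hlpi : l < Real.pi := lt_of_le_of_lt (le_of_tendsto hl (by
    filter_upwards [eventually_ge_atTop 0] with t ht
    exact hpursuit.dist_antitoneOn self_mem_Ici ht ht)) hinit
  -- An ultrafilter gives limits for all real shifts at once, with no diagonal extraction.
  let F : Ultrafilter ℝ := Ultrafilter.of atTop
  have hF : (F : Filter ℝ) ≤ atTop := Ultrafilter.of_le _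
  have hshift : ∀ s : ℝ, Tendsto (fun u : ℝ ↦ u + s) F atTop := fun s ↦
    (tendsto_atTop_add_const_right _ s tendsto_id).mono_left hF
  have hex : ∀ s : ℝ, ∃ x, Tendsto (fun u ↦ P (u + s)) F (𝓝 x) := fun s ↦
    ⟨_, (F.map fun u ↦ P (u + s)).le_nhds_lim⟩
  choose ρ hρ using hex
  have hup : ∀ s t, dist (ρ s) (ρ t) ≤ |s - t| := fun s t ↦
    le_of_tendsto ((hρ s).dist (hρ t)) (by
      filter_upwards [(hshift s).eventually_ge_atTop 0, (hshift t).eventually_ge_atTop 0]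
        with u hs ht
      simpa using hpursuit.dist_pursuer_le hs ht)
  have hlow : ∀ s t, s ≤ t → l + (t - s) < Real.pi → t - s ≤ dist (ρ s) (ρ t) := by
    intro s t hst hlt
    refine le_of_forall_lt fun c hc ↦ ?_
    obtain ⟨c', hcc', hc'⟩ := exists_between hc
    refine hcc'.trans_le (ge_of_tendsto ((hρ s).dist (hρ t)) ?_)
    filter_upwards [(hshift s).eventually
      (hpursuit.eventually_lt_dist hX hl0 hl (sub_nonneg.2 hst) hlt hc')] with u hu
    rw [add_add_sub_cancel] at hu
    exact hu.le
  refine ⟨ρ, fun t ↦ ?_, fun a b _ ↦ ?_⟩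
  · refine ⟨Metric.ball t ((Real.pi - l) / 2), Metric.ball_mem_nhds _ (by linarith), ?_⟩
    intro x hx y hy
    wlog hxy : x ≤ y generalizing x y
    · rw [dist_comm, abs_sub_comm]
      exact this y hy x hx (le_of_not_ge hxy)
    rw [Metric.mem_ball, Real.dist_eq, abs_lt] at hx hy
    refine le_antisymm (hup x y) ?_
    rw [abs_sub_comm, abs_of_nonneg (sub_nonneg.2 hxy)]
    exact hlow x y hxy (by linarith [hx.1, hy.2])
  -- Pointwise limits of 1-Lipschitz curves are uniform on [a, b]: control a finite ε/3-net.
  · have hunif : ∀ ε > 0, ∃ u ≥ 0, ∀ s ∈ Icc a b, dist (ρ s) (P (u + (s - a))) < ε := by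
      intro ε hε
      obtain ⟨N, -, hN, hcover⟩ := finite_cover_balls_of_compact
        (isCompact_Icc : IsCompact (Icc a b)) (show 0 < ε / 3 by linarith)
      have hev : ∀ᶠ u in (F : Filter ℝ), ∀ x ∈ N, dist (P (u + x)) (ρ x) < ε / 3 ∧ 0 ≤ u + x :=
        (eventually_all_finite hN).2 fun x _ ↦
          ((hρ x).eventually (Metric.ball_mem_nhds _ (by linarith))).and
            ((hshift x).eventually_ge_atTop 0)
      obtain ⟨u, hu, hua⟩ := (hev.and ((hshift a).eventually_ge_atTop 0)).exists
      refine ⟨u + a, hua, fun s hs ↦ ?_⟩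
      obtain ⟨x, hxN, hx⟩ := mem_iUnion₂.1 (hcover hs)
      rw [Metric.mem_ball, Real.dist_eq] at hx
      have h1 := (hu x hxN).1
      have h2 := hup s x
      have h3 := hpursuit.dist_pursuer_le (hu x hxN).2 (show 0 ≤ u + s by linarith [hs.1])
      rw [add_sub_add_left_eq_sub, abs_sub_comm] at h3
      have h4 := dist_triangle4 (ρ s) (ρ x) (P (u + x)) (P (u + s))
      rw [dist_comm (ρ x)] at h4
      rw [add_add_sub_cancel]
      linarith
    choose u hu0 hu using fun n : ℕ ↦ hunif (1 / (n + 1)) Nat.one_div_pos_of_nat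
    refine ⟨u, hu0, Metric.tendstoUniformlyOn_iff.2 fun ε hε ↦ ?_⟩
    filter_upwards [tendsto_one_div_add_atTop_nhds_zero_nat.eventually_lt_const hε] with n hn s hs
    exact (hu n s hs).trans hn
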